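/- Let $\mathcal V$ be a set of $n$ nodes, let $u\neq v$ be nodes, and let $\alpha>1$, $\Delta>0$, $T\in\mathbb N$, $\sigma^2\ge \Delta^2\alpha(\alpha-1)/2$ and $q=c\ln(n)/n\le 1$ with $c>1$. Let $G$ be an Erdős–Rényi random graph on $\mathcal V$ in which each edge is present independently with probability $q$; write $\mathcal N_v$ for the set of neighbors of $v$ and $d_v=|\mathcal N_v|$. A rule derives from each graph $G$ a gossip matrix $W=W_G$, that is, a symmetric matrix with nonnegative entries and rows summing to $1$, such that $W_{a,b}>0$ only if $\{a,b\}$ is an edge of $G$ or $a=b$. The rule does not distinguish the nodes that $v$ cannot see: if a permutation $\pi$ of $\mathcal V$ fixes $v$ and every neighbor of $v$ in $G$, then $(W_{\pi G})_{\pi a,\pi b}=(W_G)_{a,b}$ for all $a,b$. Muffliato on private values $x\in\mathbb R^{\mathcal V}$ draws $\eta\sim\mathcal N(0,\sigma^2 I)$ independently of $G$ and computes $x^0=x+\eta$, $x^1=Wx^0$ and $x^{t+1}=(1-\gamma)x^{t-1}+\gamma Wx^t$ for $t\ge 1$, where $$\gamma=2\,\frac{1-\sqrt{\lambda_W(1-\lambda_W/4)}}{(1-\lambda_W/2)^2},\qquad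 \lambda_W=\min_{\lambda\in \mathrm{Sp}(W)\setminus\{1\}}(1-|\lambda|)$$ (if $W$ is the identity matrix, all iterates equal $x^0$). At each time $t<T$ every node sends its value to its neighbors. The graph is private: node $v$ knows only its own neighbors, so that its view consists of $\mathcal N_v$, the values $x^t_w$ for $w\in\mathcal N_v$ and $t<T$, and its own value $x_v$. Given $\mathcal N_v$, say that $u$ is $(\alpha,\varepsilon)$-PNDP (pairwise network differentially private) with respect to $v$ if, for all $x,x'\in\mathbb R^{\mathcal V}$ that differ only in the value of $u$, with $|x_u-x'_u|\le\Delta$, the conditional laws given $\mathcal N_v$ of the view of $v$ under the inputs $x$ and $x'$ are at Rényi divergence $D_\alpha$ at most $\varepsilon$. Then, given $\mathcal N_v$, node $u$ is $(\alpha,\varepsilon)$-PNDP with respect to $v$ with $$\varepsilon=\begin{cases}\dfrac{\alpha\Delta^2}{2\sigma^2} & \text{with probability } q \text{ (when } u \text{ and } v \text{ are neighbors; this is the level of local differential privacy)},\\[2ex] \dfrac{\alpha\Delta^2}{\sigma^2}\cdot\dfrac{T d_v}{n-d_v} & \text{with probability } 1-q \text{ (when } u \text{ and } v \text{ are not neighbors)}.\end{cases}$$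 More precisely, the event that $\{u,v\}$ is an edge and the first guarantee holds has probability $q$, and the event that $\{u,v\}$ is not an edge and the second guarantee holds has probability $1-q$. -/

import Mathlib

open MeasureTheory ProbabilityTheory
open scoped NNReal ENNReal Matrix

noncomputable section

/-- The Rényi divergence of order `α` (for `α > 1`) between two laws:
`1 / (α - 1) * log ∫ (dμ/dν) ^ α dν`, with value `⊤` when `μ` has no density with respect
to `ν`. -/
def renyiDiv {Ω : Type*} [MeasurableSpace Ω] (α : ℝ) (μ ν : Measure Ω) : EReal :=
  open Classical in
  if μ ≪ ν then ((1 / (α - 1) : ℝ) : EReal) * ENNReal.log (∫⁻ z, μ.rnDeriv ν z ^ α ∂ν) else ⊤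

/-- Two families of private values that differ only in the value of user `u`, and there by at
most the sensitivity `Δ`. -/
def AdjacentData {V : Type*} (Δ : ℝ) (u : V) (x x' : V → ℝ) : Prop :=
  (∀ w, w ≠ u → x w = x' w) ∧ |x u - x' u| ≤ Δ

/-- Pairwise network differential privacy of user `u` with respect to an observer, where
`law x` is the law of what the observer sees when the private values are `x`. -/
def IsPNDP {V Ω : Type*} [MeasurableSpace Ω] (Δ α ε : ℝ) (u : V)
    (law : (V → ℝ) → Measure Ω) : Prop :=
  ∀ x x' : V → ℝ, AdjacentData Δ u x x' → renyiDiv α (law x) (law x') ≤ (ε : EReal)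

/-- Gossip matrices over a graph: symmetric, nonnegative, stochastic, and supported on the edges
and the diagonal. -/
structure IsGossipMatrix {V : Type*} [Fintype V] (G : SimpleGraph V) (W : Matrix V V ℝ) :
    Prop where
  symm : W.IsSymm
  nonneg : ∀ a b, 0 ≤ W a b
  row_sum : ∀ a, ∑ b, W a b = 1
  supp : ∀ a b, 0 < W a b → G.Adj a b ∨ a = b

/-- A rule `W` that derives a matrix from each graph treats alike all nodes other than `v` and
the neighbors of `v`: relabeling a graph `G` by a permutation that fixes `v` and each neighbor of
`v` in `G` relabels the matrix accordingly. -/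
def IsAnonymousAwayFrom {V : Type*} (W : SimpleGraph V → Matrix V V ℝ) (v : V) : Prop :=
  ∀ (G : SimpleGraph V) (π : Equiv.Perm V), π v = v → (∀ w, G.Adj v w → π w = w) →
    ∀ a b, W (G.map π.toEmbedding) (π a) (π b) = W G a b

/-- The spectral gap of a gossip matrix, i.e. the minimum of `1 - |l|` over its eigenvalues
`l ≠ 1`. (The only gossip matrix without such an eigenvalue is the identity matrix; it gets the
value `0`, and its gossip iterates are constant whatever the value is.) -/
def spectralGap {V : Type*} [Fintype V] [DecidableEq V] (W : Matrix V V ℝ) : ℝ :=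
  sInf ((fun l : ℝ => 1 - |l|) '' (spectrum ℝ W \ {1}))

/-- The acceleration parameter of Muffliato, as a function of the spectral gap `l`. -/
def accelParam (l : ℝ) : ℝ :=
  2 * (1 - Real.sqrt (l * (1 - l / 4))) / (1 - l / 2) ^ 2

/-- Chebyshev-accelerated gossip from the values `y`: `x⁰ = y`, `x¹ = W x⁰` and
`xᵗ⁺² = (1 - γ) xᵗ + γ W xᵗ⁺¹`. -/
def gossipIterate {V : Type*} [Fintype V] (γ : ℝ) (W : Matrix V V ℝ) (y : V → ℝ) :
    ℕ → V → ℝ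
  | 0 => y
  | 1 => W *ᵥ y
  | t + 2 => (1 - γ) • gossipIterate γ W y t + γ • (W *ᵥ gossipIterate γ W y (t + 1))

/-- The iterates of Muffliato with gossip matrix `W`, private values `x` and noise `η`. -/
def muffliato {V : Type*} [Fintype V] [DecidableEq V] (W : Matrix V V ℝ) (x η : V → ℝ) :
    ℕ → V → ℝ :=
  gossipIterate (accelParam (spectralGap W)) W (x + η)

/-- The joint law of the Erdős–Rényi graph of parameter `q` and of the independent Gaussian
noises of variance `σ ^ 2` that the nodes add to their values. -/
def graphNoiseLaw (V : Type*) [Fintype V] (q : unitInterval) (σ : ℝ≥0) :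
    Measure (SimpleGraph V × (V → ℝ)) :=
  (SimpleGraph.binomialRandom V q).prod (Measure.pi fun _ : V => gaussianReal 0 (σ ^ 2))

/-- The law of the view of node `v` after `T` rounds of Muffliato, given that the set of neighbors
of `v` in the random graph is `N`. The view consists of the values that `v` receives from its
neighbors `w ∈ N` at the times `t < T`, and of the private value of `v`. Nothing else is revealed
about the graph: given `N`, the rest of it is random and is averaged out. -/
def viewLaw {V : Type*} [Fintype V] [DecidableEq V] (q : unitInterval) (σ : ℝ≥0)
    (W : SimpleGraph V → Matrix V V ℝ) (T : ℕ) (v : V) (N : Set V) (x : V → ℝ) :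
    Measure ((Fin T → N → ℝ) × ℝ) :=
  Measure.map
    (fun ω : SimpleGraph V × (V → ℝ) =>
      ((fun (t : Fin T) (w : N) => muffliato (W ω.1) x ω.2 t w), x v))
    (ProbabilityTheory.cond (graphNoiseLaw V q σ) {ω | ω.1.neighborSet v = N})

end

/-!
Given the graph `G`, the values that `v` receives are linear functionals of `x + η`. Let `K` be the
span of these functionals and `P` the orthogonal projection to `K`. The inputs `x` and
`x' + P (x - x')` yield the same view, so in place of `x` and `x'` one may compare two inputs that
differ by `P (x - x')` only. The Rényi divergence of order `α` given `G` is therefore at most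
`α * (x u - x' u) ^ 2 * r / (2 * σ ^ 2)`, where the exposure `r = ‖P e_u‖ ^ 2 ≤ 1` of `u` is the
part of its coordinate that `K` reveals. For `r ≤ 1` this is the level of local differential
privacy.

To average over the unknown part of `G`, one writes the translation of the noise as a density on the
joint space of graph and noise and applies the data processing inequality (`renyiDiv_map_le`) once:
`exp ((α - 1) * D)` is at most the mean over `G`, given the neighbors of `v`, of the exponentials
`exp (α * (α - 1) * (x u - x' u) ^ 2 * r / (2 * σ ^ 2))` (`renyiDiv_viewLaw_le`). By the assumption
on `σ` the exponents are at most `1`, so `exp c ≤ 1 + 2 * c` and `1 + c ≤ exp c` bound `D` by twice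
the mean of the conditional divergences, which leaves the mean of `r` to be estimated.

The exposures of all nodes add up to the dimension of `K`, which is at most `T * d`, with `d` the
number of neighbors of `v`. Given these neighbors, the law of `G` is invariant under permutations of
the nodes that `v` does not see, and so is the rule for the matrix; hence the `n - d - 1` unseen
nodes have the same mean exposure `R`. If `0 < T`, then each neighbor of `v` has exposure `1`,
because it sends its initial value. So `(n - d - 1) * R + d ≤ T * d`, and as `R ≤ 1 ≤ d` (or `R = 0`
if `d = 0`), `(n - d) * R ≤ T * d` (`integral_exposure_le`).
-/

/-! ### Data processing for the Rényi divergence -/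

/-- The integral that defines the Rényi divergence does not grow under a measurable map. With `g`
the density of the image laws, `∫ g ^ α ≤ ∫ (g ∘ f) ^ (α - 1) * h`, and Hölder's inequality bounds
this by `(∫ g ^ α) ^ (1 - 1 / α) * (∫ h ^ α) ^ (1 / α)`. Truncating `g` allows one to divide. -/
theorem lintegral_rnDeriv_map_rpow_le {X Y : Type*} [MeasurableSpace X] [MeasurableSpace Y]
    {μ ν : Measure X} [IsFiniteMeasure μ] [IsFiniteMeasure ν] {h : X → ℝ≥0∞} (hh : Measurable h)
    (hμ : μ = ν.withDensity h) {f : X → Y} (hf : Measurable f) {α : ℝ} (hα : 1 < α) :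
    ∫⁻ z, (μ.map f).rnDeriv (ν.map f) z ^ α ∂(ν.map f) ≤ ∫⁻ z, h z ^ α ∂ν := by
  set g := (μ.map f).rnDeriv (ν.map f) with hg_def
  have hg : Measurable g := Measure.measurable_rnDeriv _ _
  have hac : μ.map f ≪ ν.map f := by
    rw [hμ]; exact (withDensity_absolutelyContinuous ν h).map hf
  have hgd : (ν.map f).withDensity g = μ.map f := Measure.withDensity_rnDeriv_eq _ _ hac
  have hα0 : 0 < α := by linarith
  have hpq : α.HolderConjugate (α / (α - 1)) := Real.HolderConjugate.conjExponent hα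
  let G : ℕ → Y → ℝ≥0∞ := fun k z => min (g z) k
  have hG : ∀ k, Measurable (G k) := fun k => hg.min measurable_const
  have key : ∀ k, ∫⁻ z, G k z ^ α ∂(ν.map f) ≤ ∫⁻ z, h z ^ α ∂ν := by
    intro k
    set A := ∫⁻ z, G k z ^ α ∂(ν.map f) with hA
    set B := ∫⁻ z, h z ^ α ∂ν
    have hAtop : A ≠ ∞ := by
      have : A ≤ ∫⁻ _, (k : ℝ≥0∞) ^ α ∂(ν.map f) :=
        lintegral_mono fun z => ENNReal.rpow_le_rpow (min_le_right _ _) hα0.le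
      rw [lintegral_const] at this
      exact ne_top_of_le_ne_top (ENNReal.mul_ne_top
        (ENNReal.rpow_ne_top_of_nonneg hα0.le (ENNReal.natCast_ne_top k)) (measure_ne_top _ _)) this
    rcases eq_or_ne A 0 with hA0 | hA0
    · rw [hA0]; exact zero_le
    have h1 : A ≤ B ^ (1 / α) * A ^ (1 / (α / (α - 1))) := by
      calc A ≤ ∫⁻ z, (g * fun z => G k z ^ (α - 1)) z ∂(ν.map f) := by
            refine lintegral_mono fun z => ?_
            have : G k z ^ α = G k z * G k z ^ (α - 1) := by
              conv_rhs => rw [← ENNReal.rpow_one (G k z)]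
              rw [← ENNReal.rpow_mul, ← ENNReal.rpow_add_of_nonneg _ _ zero_le_one (by linarith)]
              congr 1; ring
            simp only [Pi.mul_apply]
            rw [this]
            gcongr
            exact min_le_left _ _
        _ = ∫⁻ z, G k z ^ (α - 1) ∂(μ.map f) := by
            rw [← lintegral_withDensity_eq_lintegral_mul _ hg ((hG k).pow_const _), hgd]
        _ = ∫⁻ x, (h * fun x => G k (f x) ^ (α - 1)) x ∂ν := by
            rw [lintegral_map ((hG k).pow_const _) hf, hμ]
            exact lintegral_withDensity_eq_lintegral_mul _ hh (((hG k).comp hf).pow_const _)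
        _ ≤ B ^ (1 / α) * (∫⁻ x, (G k (f x) ^ (α - 1)) ^ (α / (α - 1)) ∂ν)
              ^ (1 / (α / (α - 1))) :=
            ENNReal.lintegral_mul_le_Lp_mul_Lq ν hpq hh.aemeasurable
              (((hG k).comp hf).pow_const _).aemeasurable
        _ = B ^ (1 / α) * A ^ (1 / (α / (α - 1))) := by
            congr 2
            rw [hA, lintegral_map ((hG k).pow_const _) hf]
            refine lintegral_congr fun x => ?_
            rw [← ENNReal.rpow_mul]
            congr 1
            field_simp [(by linarith : α - 1 ≠ 0)]
    have h2 : A = A ^ (1 / α) * A ^ (1 / (α / (α - 1))) := by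
      rw [← ENNReal.rpow_add _ _ hA0 hAtop]
      have : 1 / α + 1 / (α / (α - 1)) = 1 := by
        simpa [one_div] using hpq.inv_add_inv_eq_one
      rw [this, ENNReal.rpow_one]
    have h3 : A ^ (1 / α) ≤ B ^ (1 / α) := by
      have hne : A ^ (1 / (α / (α - 1))) ≠ 0 := by simp [hA0, hAtop]
      have hnt : A ^ (1 / (α / (α - 1))) ≠ ∞ :=
        ENNReal.rpow_ne_top_of_nonneg (one_div_nonneg.2 hpq.symm.nonneg) hAtop
      exact (ENNReal.mul_le_mul_iff_left hne hnt).1 (h2.symm.trans_le h1)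
    exact (ENNReal.rpow_le_rpow_iff (by positivity)).1 h3
  have hlim : Filter.Tendsto (fun k => ∫⁻ z, G k z ^ α ∂(ν.map f)) Filter.atTop
      (nhds (∫⁻ z, g z ^ α ∂(ν.map f))) := by
    refine lintegral_tendsto_of_tendsto_of_monotone (fun k => ((hG k).pow_const _).aemeasurable)
      (Filter.Eventually.of_forall fun z i j hij => ENNReal.rpow_le_rpow
        (min_le_min le_rfl (by exact_mod_cast hij)) hα0.le)
      (Filter.Eventually.of_forall fun z => ?_)
    refine (ENNReal.continuous_rpow_const.tendsto _).comp ?_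
    have := (tendsto_const_nhds (x := g z)).min ENNReal.tendsto_nat_nhds_top
    simpa [G] using this
  exact le_of_tendsto' hlim key

theorem renyiDiv_map_le {X Y : Type*} [MeasurableSpace X] [MeasurableSpace Y]
    {μ ν : Measure X} [IsFiniteMeasure μ] [IsFiniteMeasure ν] {h : X → ℝ≥0∞} (hh : Measurable h)
    (hμ : μ = ν.withDensity h) {f : X → Y} (hf : Measurable f) {α : ℝ} (hα : 1 < α) :
    renyiDiv α (μ.map f) (ν.map f) ≤
      ((1 / (α - 1) : ℝ) : EReal) * ENNReal.log (∫⁻ z, h z ^ α ∂ν) := by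
  have hac : μ.map f ≪ ν.map f := by
    rw [hμ]; exact (withDensity_absolutelyContinuous ν h).map hf
  rw [renyiDiv, if_pos hac]
  refine mul_le_mul_of_nonneg_left (ENNReal.log_monotone
    (lintegral_rnDeriv_map_rpow_le hh hμ hf hα)) ?_
  exact_mod_cast one_div_nonneg.2 (by linarith)

/-! ### Translations of Gaussian noise -/

theorem lintegral_pi_prod {ι : Type*} [Fintype ι] {X : ι → Type*} [∀ i, MeasurableSpace (X i)]
    (μ : ∀ i, Measure (X i)) [∀ i, IsProbabilityMeasure (μ i)] {f : ∀ i, X i → ℝ≥0∞}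
    (hf : ∀ i, Measurable (f i)) :
    ∫⁻ x, ∏ i, f i (x i) ∂Measure.pi μ = ∏ i, ∫⁻ y, f i y ∂μ i := by
  rw [lintegral_prod_eq_prod_lintegral_of_indepFun Finset.univ
    (fun i (x : ∀ i, X i) => f i (x i)) (iIndepFun_pi fun i => (hf i).aemeasurable)
    fun i => (hf i).comp (measurable_pi_apply i)]
  exact Finset.prod_congr rfl fun i _ =>
    (measurePreserving_eval μ i).lintegral_comp (hf i)

theorem pi_withDensity {ι : Type*} [Fintype ι] {X : ι → Type*} [∀ i, MeasurableSpace (X i)]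
    (μ : ∀ i, Measure (X i)) [∀ i, IsProbabilityMeasure (μ i)] {f : ∀ i, X i → ℝ≥0∞}
    (hf : ∀ i, Measurable (f i)) [∀ i, SigmaFinite ((μ i).withDensity (f i))] :
    Measure.pi (fun i => (μ i).withDensity (f i)) =
      (Measure.pi μ).withDensity fun x => ∏ i, f i (x i) := by
  refine Measure.pi_eq fun s hs => ?_
  rw [withDensity_apply _ (MeasurableSet.univ_pi hs),
    ← lintegral_indicator (MeasurableSet.univ_pi hs)]
  have : (Set.univ.pi s).indicator (fun x => ∏ i, f i (x i)) =
      fun x => ∏ i, (s i).indicator (f i) (x i) := by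
    ext x
    by_cases hx : x ∈ Set.univ.pi s
    · rw [Set.indicator_of_mem hx]
      exact Finset.prod_congr rfl fun i _ => (Set.indicator_of_mem (hx i trivial) _).symm
    · rw [Set.indicator_of_notMem hx]
      simp only [Set.mem_univ_pi, not_forall] at hx
      obtain ⟨i, hi⟩ := hx
      exact (Finset.prod_eq_zero (Finset.mem_univ i) (Set.indicator_of_notMem hi _)).symm
  rw [this, lintegral_pi_prod μ fun i => (hf i).indicator (hs i)]
  exact Finset.prod_congr rfl fun i _ => by
    rw [withDensity_apply _ (hs i), lintegral_indicator (hs i)]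

/-- The density of the centered Gaussian of variance `v` translated by `s` with respect to the
centered Gaussian itself. -/
noncomputable def gaussianShiftDensity (v : ℝ≥0) (s y : ℝ) : ℝ≥0∞ :=
  ENNReal.ofReal (Real.exp ((s * y - s ^ 2 / 2) / v))

@[fun_prop]
theorem measurable_gaussianShiftDensity (v : ℝ≥0) (s : ℝ) :
    Measurable (gaussianShiftDensity v s) := by
  unfold gaussianShiftDensity; fun_prop

theorem gaussianReal_map_add_eq_withDensity {v : ℝ≥0} (hv : v ≠ 0) (s : ℝ) :
    (gaussianReal 0 v).map (· + s) = (gaussianReal 0 v).withDensity (gaussianShiftDensity v s) := by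
  rw [gaussianReal_map_add_const, zero_add, gaussianReal_of_var_ne_zero _ hv,
    gaussianReal_of_var_ne_zero _ hv, ← withDensity_mul _ (measurable_gaussianPDF _ _)
      (measurable_gaussianShiftDensity v s)]
  congr 1
  ext y
  have hv' : (v : ℝ) ≠ 0 := by exact_mod_cast hv
  simp only [Pi.mul_apply, gaussianPDF, gaussianShiftDensity, gaussianPDFReal]
  rw [← ENNReal.ofReal_mul (by positivity), mul_assoc (_⁻¹), ← Real.exp_add]
  congr 3
  field_simp
  ring

theorem lintegral_gaussianShiftDensity_rpow {v : ℝ≥0} (hv : v ≠ 0) (s : ℝ) {α : ℝ} (hα : 0 ≤ α) :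
    ∫⁻ y, gaussianShiftDensity v s y ^ α ∂gaussianReal 0 v =
      ENNReal.ofReal (Real.exp (α * (α - 1) * s ^ 2 / (2 * v))) := by
  have hv' : (v : ℝ) ≠ 0 := by exact_mod_cast hv
  have h1 : ∀ y, gaussianShiftDensity v s y ^ α =
      ENNReal.ofReal (Real.exp (-(α * s ^ 2 / (2 * v))) * Real.exp (α * s / v * y)) := fun y => by
    rw [gaussianShiftDensity, ENNReal.ofReal_rpow_of_nonneg (Real.exp_pos _).le hα, ← Real.exp_mul,
      ← Real.exp_add]
    congr 2
    field_simp
    ring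
  simp_rw [h1]
  rw [← ofReal_integral_eq_lintegral_ofReal
    ((integrable_exp_mul_gaussianReal _).const_mul _)
    (Filter.Eventually.of_forall fun y => by positivity), integral_const_mul]
  have := congrFun (mgf_fun_id_gaussianReal (μ := 0) (v := v)) (α * s / v)
  rw [mgf] at this
  rw [this, ← Real.exp_add]
  congr 2
  field_simp
  ring

/-- Translating the noise of a random object `(G, y)` by a vector that may depend on `G` changes
its law by an explicit density. -/
theorem prod_pi_gaussianReal_map_shift {Γ V : Type*} [Fintype V] [MeasurableSpace Γ]
    [Countable Γ] [MeasurableSingletonClass Γ] (κ : Measure Γ) [IsFiniteMeasure κ]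
    {v : ℝ≥0} (hv : v ≠ 0) (s : Γ → V → ℝ) :
    (κ.prod (Measure.pi fun _ : V => gaussianReal 0 v)).map (fun ω => (ω.1, ω.2 + s ω.1)) =
      (κ.prod (Measure.pi fun _ : V => gaussianReal 0 v)).withDensity
        fun ω => ∏ w, gaussianShiftDensity v (s ω.1 w) (ω.2 w) := by
  have hS : Measurable fun ω : Γ × (V → ℝ) => (ω.1, ω.2 + s ω.1) :=
    measurable_fst.prodMk (measurable_snd.add ((measurable_of_countable s).comp measurable_fst))
  have hD : Measurable fun ω : Γ × (V → ℝ) =>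
      ∏ w, gaussianShiftDensity v (s ω.1 w) (ω.2 w) :=
    measurable_from_prod_countable_right fun G => by
      dsimp only; fun_prop
  have hone : ∀ t : V → ℝ, (Measure.pi fun _ : V => gaussianReal 0 v).map (· + t) =
      (Measure.pi fun _ : V => gaussianReal 0 v).withDensity
        fun y => ∏ w, gaussianShiftDensity v (t w) (y w) := fun t => by
    have hp : ∀ w, IsProbabilityMeasure
        ((gaussianReal 0 v).withDensity (gaussianShiftDensity v (t w))) := fun w => by
      rw [← gaussianReal_map_add_eq_withDensity hv]
      exact Measure.isProbabilityMeasure_map (by fun_prop)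
    rw [← pi_withDensity (fun _ : V => gaussianReal 0 v)
      (fun w => measurable_gaussianShiftDensity v (t w))]
    simp_rw [← gaussianReal_map_add_eq_withDensity hv]
    rw [← Measure.pi_map_pi (fun _ => by fun_prop)]
    rfl
  ext A hA
  rw [Measure.map_apply hS hA, Measure.prod_apply (hS hA), withDensity_apply _ hA,
    ← lintegral_indicator hA, lintegral_prod _ (hD.indicator hA).aemeasurable]
  refine lintegral_congr fun G => ?_
  have hAG : MeasurableSet (Prod.mk G ⁻¹' A) := measurable_prodMk_left hA
  have := congrArg (fun m => m (Prod.mk G ⁻¹' A)) (hone (s G))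
  rw [Measure.map_apply (by fun_prop) hAG, withDensity_apply _ hAG, ← lintegral_indicator hAG]
    at this
  exact this

theorem lintegral_prod_gaussianShiftDensity_rpow {Γ V : Type*} [Fintype V] [MeasurableSpace Γ]
    [Countable Γ] [MeasurableSingletonClass Γ] (κ : Measure Γ) [IsFiniteMeasure κ]
    {v : ℝ≥0} (hv : v ≠ 0) (s : Γ → V → ℝ) {α : ℝ} (hα : 0 ≤ α) :
    ∫⁻ ω, (∏ w, gaussianShiftDensity v (s ω.1 w) (ω.2 w)) ^ α
        ∂(κ.prod (Measure.pi fun _ : V => gaussianReal 0 v)) =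
      ∫⁻ G, ENNReal.ofReal (Real.exp (α * (α - 1) / (2 * v) * ∑ w, s G w ^ 2)) ∂κ := by
  have hD : Measurable fun ω : Γ × (V → ℝ) =>
      (∏ w, gaussianShiftDensity v (s ω.1 w) (ω.2 w)) ^ α :=
    measurable_from_prod_countable_right fun G => by
      dsimp only; fun_prop
  rw [lintegral_prod _ hD.aemeasurable]
  refine lintegral_congr fun G => ?_
  simp_rw [← ENNReal.prod_rpow_of_nonneg hα]
  rw [lintegral_pi_prod (fun _ : V => gaussianReal 0 v)
    (f := fun w y => gaussianShiftDensity v (s G w) y ^ α) (fun w => by fun_prop)]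
  simp_rw [lintegral_gaussianShiftDensity_rpow hv _ hα]
  rw [← ENNReal.ofReal_prod_of_nonneg fun _ _ => (Real.exp_pos _).le, ← Real.exp_sum,
    Finset.mul_sum]
  congr 3
  ext w
  ring

/-! ### What a linear observation reveals of one coordinate -/

/-- The part of the `w`-th coordinate that the linear functionals in `K` reveal: the squared norm
of the projection to `K` of the `w`-th unit vector. -/
noncomputable def exposure {V : Type*} [Fintype V] [DecidableEq V]
    (K : Submodule ℝ (EuclideanSpace ℝ V)) (w : V) : ℝ :=
  ‖K.starProjection (EuclideanSpace.single w 1)‖ ^ 2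

section exposure

variable {V : Type*} [Fintype V] [DecidableEq V] (K : Submodule ℝ (EuclideanSpace ℝ V))

theorem exposure_nonneg (w : V) : 0 ≤ exposure K w := sq_nonneg _

theorem exposure_le_one (w : V) : exposure K w ≤ 1 := by
  have h := K.norm_starProjection_apply_le (EuclideanSpace.single w (1 : ℝ))
  rw [PiLp.norm_single, norm_one] at h
  exact pow_le_one₀ (norm_nonneg _) h

variable {K} in
theorem exposure_eq_one {w : V} (h : EuclideanSpace.single w (1 : ℝ) ∈ K) : exposure K w = 1 := by
  rw [exposure, Submodule.starProjection_eq_self_iff.2 h, PiLp.norm_single, norm_one,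
    one_pow]

/-- The total exposure is the trace of the projection to `K`. -/
theorem sum_exposure : ∑ w, exposure K w = Module.finrank ℝ K := by
  have hproj : LinearMap.IsProj K (K.starProjection : EuclideanSpace ℝ V →ₗ[ℝ] _) :=
    ⟨fun x => K.starProjection_apply_mem x, fun x hx => Submodule.starProjection_eq_self_iff.2 hx⟩
  rw [← hproj.trace, LinearMap.trace_eq_sum_inner _ (EuclideanSpace.basisFun V ℝ)]
  refine Finset.sum_congr rfl fun w _ => ?_
  rw [EuclideanSpace.basisFun_apply, exposure, ← real_inner_self_eq_norm_sq]
  simp only [ContinuousLinearMap.coe_coe]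
  rw [Submodule.inner_starProjection_left_eq_right,
    Submodule.starProjection_eq_self_iff.2 (K.starProjection_apply_mem _)]

theorem exposure_map_piLpCongrLeft (π : Equiv.Perm V) (w : V) :
    exposure (K.map (LinearIsometryEquiv.piLpCongrLeft 2 ℝ ℝ π).toLinearEquiv.toLinearMap) (π w) =
      exposure K w := by
  have h : EuclideanSpace.single (π w) (1 : ℝ) =
      LinearIsometryEquiv.piLpCongrLeft 2 ℝ ℝ π (EuclideanSpace.single w 1) :=
    (EuclideanSpace.piLpCongrLeft_single π w 1).symm
  rw [exposure, exposure, h,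
    ← (LinearIsometryEquiv.piLpCongrLeft 2 ℝ ℝ π).norm_map (K.starProjection _)]
  congr 2
  have := Submodule.starProjection_map_apply (LinearIsometryEquiv.piLpCongrLeft 2 ℝ ℝ π) K
    (LinearIsometryEquiv.piLpCongrLeft 2 ℝ ℝ π (EuclideanSpace.single w 1))
  rw [LinearIsometryEquiv.symm_apply_apply] at this
  exact this

end exposure

/-! ### Gossip iterates as linear observations -/

section gossip

variable {V : Type*} [Fintype V] [DecidableEq V]

/-- The matrix of the linear map that sends the initial values to the `t`-th gossip iterate. -/
noncomputable def gossipMatrix (γ : ℝ) (W : Matrix V V ℝ) : ℕ → Matrix V V ℝ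
  | 0 => 1
  | 1 => W
  | t + 2 => (1 - γ) • gossipMatrix γ W t + γ • (W * gossipMatrix γ W (t + 1))

theorem gossipIterate_eq_mulVec (γ : ℝ) (W : Matrix V V ℝ) (y : V → ℝ) (t : ℕ) :
    gossipIterate γ W y t = gossipMatrix γ W t *ᵥ y := by
  induction t using Nat.twoStepInduction with
  | zero => simp [gossipIterate, gossipMatrix]
  | one => simp [gossipIterate, gossipMatrix]
  | more t h1 h2 =>
    rw [gossipIterate, h1, h2, gossipMatrix, Matrix.add_mulVec, Matrix.smul_mulVec,
      Matrix.smul_mulVec, Matrix.mulVec_mulVec]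

theorem gossipMatrix_reindex (γ : ℝ) (W : Matrix V V ℝ) (π : Equiv.Perm V) (t : ℕ) :
    gossipMatrix γ (W.reindex π π) t = (gossipMatrix γ W t).reindex π π := by
  induction t using Nat.twoStepInduction with
  | zero => simp [gossipMatrix]
  | one => rfl
  | more t h1 h2 =>
    rw [gossipMatrix, h1, h2, gossipMatrix]
    simp only [Matrix.reindex_apply, Matrix.submatrix_mul_equiv]
    rfl

theorem spectralGap_reindex (W : Matrix V V ℝ) (π : Equiv.Perm V) :
    spectralGap (W.reindex π π) = spectralGap W := by
  rw [spectralGap, spectralGap, ← Matrix.coe_reindexAlgEquiv ℝ ℝ, AlgEquiv.spectrum_eq]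

/-- The span of the functionals of the initial values that the nodes of `N` hold before time `T`. -/
noncomputable def observedSpace (W : Matrix V V ℝ) (T : ℕ) (N : Set V) :
    Submodule ℝ (EuclideanSpace ℝ V) :=
  Submodule.span ℝ (Set.range fun p : Fin T × N =>
    WithLp.toLp 2 (gossipMatrix (accelParam (spectralGap W)) W p.1 p.2))

theorem finrank_observedSpace_le (W : Matrix V V ℝ) (T : ℕ) (N : Set V) :
    Module.finrank ℝ (observedSpace W T N) ≤ T * N.ncard := by
  classical
  refine (finrank_range_le_card _).trans_eq ?_
  rw [Fintype.card_prod, Fintype.card_fin, Set.ncard_eq_toFinset_card', Set.toFinset_card]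

theorem single_mem_observedSpace (W : Matrix V V ℝ) {T : ℕ} (hT : 0 < T) {N : Set V} {w : V}
    (hw : w ∈ N) : EuclideanSpace.single w (1 : ℝ) ∈ observedSpace W T N := by
  refine Submodule.subset_span ⟨(⟨0, hT⟩, ⟨w, hw⟩), ?_⟩
  ext i
  simp [gossipMatrix, Matrix.one_apply, eq_comm]

theorem observedSpace_reindex (W : Matrix V V ℝ) (T : ℕ) {N : Set V} {π : Equiv.Perm V}
    (hπ : ∀ w ∈ N, π w = w) :
    observedSpace (W.reindex π π) T N = (observedSpace W T N).map
      (LinearIsometryEquiv.piLpCongrLeft 2 ℝ ℝ π).toLinearEquiv.toLinearMap := by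
  rw [observedSpace, observedSpace, Submodule.map_span, ← Set.range_comp]
  congr 2
  ext p i
  have h : π.symm p.2 = p.2 := by rw [Equiv.symm_apply_eq, hπ _ p.2.2]
  rw [spectralGap_reindex, gossipMatrix_reindex]
  simp [h, LinearIsometryEquiv.piLpCongrLeft_apply, Equiv.piCongrLeft']

/-- Private values enter what the nodes of `N` hold only through their projection to the observed
space. -/
theorem muffliato_add_starProjection (W : Matrix V V ℝ) {T : ℕ} {N : Set V} (x x' η : V → ℝ)
    {t : ℕ} (ht : t < T) {w : V} (hw : w ∈ N) :
    muffliato W x' (η + (observedSpace W T N).starProjection (WithLp.toLp 2 (x - x'))) t w =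
      muffliato W x η t w := by
  set K := observedSpace W T N
  set d : EuclideanSpace ℝ V := WithLp.toLp 2 (x - x')
  have hr : WithLp.toLp 2 (gossipMatrix (accelParam (spectralGap W)) W t w) ∈ K :=
    Submodule.subset_span ⟨(⟨t, ht⟩, ⟨w, hw⟩), rfl⟩
  have horth := Submodule.inner_right_of_mem_orthogonal hr
    (K.sub_starProjection_mem_orthogonal d)
  rw [muffliato, muffliato, gossipIterate_eq_mulVec, gossipIterate_eq_mulVec, ← sub_eq_zero,
    ← Pi.sub_apply, ← Matrix.mulVec_sub, ← neg_eq_zero, ← horth, PiLp.inner_apply, Matrix.mulVec,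
    dotProduct, ← Finset.sum_neg_distrib]
  refine Finset.sum_congr rfl fun i _ => ?_
  simp [d]
  ring

end gossip

/-! ### Symmetries of the random graph -/

section randomGraph

variable {V : Type*} [Fintype V]

instance : MeasurableSingletonClass (SimpleGraph V) where
  measurableSet_singleton G := by
    have : ({G} : Set (SimpleGraph V)) = SimpleGraph.edgeSet ⁻¹' {G.edgeSet} := by
      ext H; simp
    rw [this]
    exact SimpleGraph.measurable_edgeSet (measurableSet_singleton _)

theorem binomialRandom_real_adj (q : unitInterval) {u v : V} (huv : u ≠ v) :
    (SimpleGraph.binomialRandom V q).real {G | G.Adj u v} = q := by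
  have h : SimpleGraph.binomialRandom V q {G | G.Adj u v} = unitInterval.toNNReal q := by
    have hi : SimpleGraph.edgeSet '' {G : SimpleGraph V | G.Adj u v} =
        {s ∈ {s : Set (Sym2 V) | s(u, v) ∈ s} | s ⊆ Sym2.diagSetᶜ} := by
      ext s
      constructor
      · rintro ⟨G, hG, rfl⟩
        exact ⟨hG, G.edgeSet_subset_compl_diagSet⟩
      · rintro ⟨h1, h2⟩
        refine ⟨SimpleGraph.fromEdgeSet s, ?_, ?_⟩
        · simpa using ⟨h1, huv⟩
        · rw [SimpleGraph.edgeSet_fromEdgeSet]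
          exact sdiff_eq_left.2 (Set.subset_compl_iff_disjoint_right.1 h2)
    rw [SimpleGraph.binomialRandom_apply', hi, ← setBernoulli_apply_eq_apply_subsets]
    calc _ = Measure.infinitePi (fun i : Sym2 V => unitInterval.toNNReal q •
            Measure.dirac (i ∈ (Sym2.diagSet : Set (Sym2 V))ᶜ) +
              unitInterval.toNNReal (unitInterval.symm q) • Measure.dirac False)
          (cylinder {s(u, v)} {fun _ => True}) := by
          rw [setBernoulli_apply']; congr!; ext; simp [funext_iff]
      _ = unitInterval.toNNReal q := by
          rw [Measure.infinitePi_cylinder _ (by simp)]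
          simp [huv]
  rw [measureReal_def, h]
  rfl

theorem binomialRandom_map_perm (q : unitInterval) (π : Equiv.Perm V) :
    (SimpleGraph.binomialRandom V q).map (fun G => G.map π.toEmbedding) =
      SimpleGraph.binomialRandom V q := by
  refine Measure.ext_of_singleton fun H => ?_
  rw [Measure.map_apply (measurable_of_countable _) (measurableSet_singleton _)]
  have hpre : (fun G : SimpleGraph V => G.map π.toEmbedding) ⁻¹' {H} =
      {H.comap π.toEmbedding} := by
    ext G
    simp only [Set.mem_preimage, Set.mem_singleton_iff]
    constructor
    · rintro rfl
      exact (SimpleGraph.comap_map_eq π.toEmbedding G).symm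
    · rintro rfl
      ext a b
      obtain ⟨a, rfl⟩ := π.surjective a
      obtain ⟨b, rfl⟩ := π.surjective b
      exact SimpleGraph.map_adj_apply (f := π.toEmbedding)
  rw [hpre, SimpleGraph.binomialRandom_singleton, SimpleGraph.binomialRandom_singleton]
  have hc : (H.comap π.toEmbedding).edgeSet.ncard = H.edgeSet.ncard := by
    rw [← Nat.card_coe_set_eq, ← Nat.card_coe_set_eq]
    exact Nat.card_congr (SimpleGraph.Iso.comap π H).mapEdgeSet
  rw [hc]

/-- The law of the random graph given that the set of neighbors of `v` is `N`. -/
noncomputable def graphLawGiven (q : unitInterval) (v : V) (N : Set V) :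
    Measure (SimpleGraph V) :=
  ProbabilityTheory.cond (SimpleGraph.binomialRandom V q) {G | G.neighborSet v = N}

theorem ae_graphLawGiven (q : unitInterval) (v : V) (N : Set V) :
    ∀ᵐ G ∂graphLawGiven q v N, G.neighborSet v = N :=
  ae_cond_mem (Set.toFinite _).measurableSet

theorem graphLawGiven_map_perm (q : unitInterval) (v : V) (N : Set V) {π : Equiv.Perm V}
    (hv : π v = v) (hN : ∀ w ∈ N, π w = w) :
    (graphLawGiven q v N).map (fun G => G.map π.toEmbedding) = graphLawGiven q v N := by
  have hNs : ∀ w, π w ∈ N ↔ w ∈ N := fun w =>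
    ⟨fun h => by rwa [π.injective (hN _ h)] at h, fun h => by rwa [hN w h]⟩
  have hpre : (fun G : SimpleGraph V => G.map π.toEmbedding) ⁻¹' {G | G.neighborSet v = N} =
      {G | G.neighborSet v = N} := by
    ext G
    have hadj : ∀ w, (G.map π.toEmbedding).Adj v (π w) ↔ G.Adj v w := fun w => by
      conv_lhs => rw [← hv]
      exact SimpleGraph.map_adj_apply (f := π.toEmbedding)
    simp only [Set.mem_preimage, Set.mem_ofPred_eq, Set.ext_iff, SimpleGraph.mem_neighborSet]
    rw [← π.forall_congr_right]
    simp only [hadj, hNs]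
  rw [graphLawGiven, ProbabilityTheory.cond, Measure.map_smul]
  congr 1
  conv_lhs => rw [← hpre]
  rw [← Measure.restrict_map (measurable_of_countable _) (Set.toFinite _).measurableSet,
    binomialRandom_map_perm]

theorem cond_graphNoiseLaw (q : unitInterval) (σ : ℝ≥0) (v : V) (N : Set V) :
    ProbabilityTheory.cond (graphNoiseLaw V q σ) {ω | ω.1.neighborSet v = N} =
      (graphLawGiven q v N).prod (Measure.pi fun _ : V => gaussianReal 0 (σ ^ 2)) := by
  have hs : {ω : SimpleGraph V × (V → ℝ) | ω.1.neighborSet v = N} =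
      {G | G.neighborSet v = N} ×ˢ Set.univ := by
    ext; simp
  rw [graphLawGiven, ProbabilityTheory.cond, ProbabilityTheory.cond, hs, graphNoiseLaw,
    Measure.prod_prod, measure_univ, mul_one, ← Measure.prod_restrict, Measure.restrict_univ,
    Measure.prod_smul_left]

variable [DecidableEq V] {q : unitInterval} {v : V} {N : Set V}
  {W : SimpleGraph V → Matrix V V ℝ} (T : ℕ)

/-- Swapping two nodes that `v` does not see leaves the random graph unchanged in law, hence also
their mean exposures. -/
theorem integral_exposure_eq (hWv : IsAnonymousAwayFrom W v) {a b : V} (hav : a ≠ v) (haN : a ∉ N)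
    (hbv : b ≠ v) (hbN : b ∉ N) :
    ∫ G, exposure (observedSpace (W G) T N) a ∂graphLawGiven q v N =
      ∫ G, exposure (observedSpace (W G) T N) b ∂graphLawGiven q v N := by
  set π := Equiv.swap a b
  have hπv : π v = v := Equiv.swap_apply_of_ne_of_ne hav.symm hbv.symm
  have hπN : ∀ w ∈ N, π w = w := fun w hw => Equiv.swap_apply_of_ne_of_ne
    (fun h => haN (h ▸ hw)) (fun h => hbN (h ▸ hw))
  conv_rhs => rw [← graphLawGiven_map_perm q v N hπv hπN]
  rw [integral_map (measurable_of_countable _).aemeasurable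
    (measurable_of_countable _).aestronglyMeasurable]
  refine integral_congr_ae ?_
  filter_upwards [ae_graphLawGiven q v N] with G hG
  have hWG : W (G.map π.toEmbedding) = (W G).reindex π π := by
    ext i j
    have := hWv G π hπv (fun w hw => hπN w (hG ▸ hw)) (π.symm i) (π.symm j)
    simpa using this
  have hb : b = π a := (Equiv.swap_apply_left a b).symm
  rw [hWG, observedSpace_reindex _ _ hπN, hb, exposure_map_piLpCongrLeft]

/-- The exposures add up to at most `T * d`. If `0 < T`, then the `d` neighbors of `v` account for
`d` of this, and the `n - d - 1` nodes that `v` does not see have equal shares, each at most `1`, of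
the rest. -/
theorem integral_exposure_le [IsProbabilityMeasure (graphLawGiven q v N)]
    (hWv : IsAnonymousAwayFrom W v) (hvN : v ∉ N) {u : V} (huv : u ≠ v) (huN : u ∉ N) :
    ((Fintype.card V : ℝ) - N.ncard) *
      ∫ G, exposure (observedSpace (W G) T N) u ∂graphLawGiven q v N ≤ T * N.ncard := by
  classical
  set κ := graphLawGiven q v N
  let R : V → ℝ := fun w => ∫ G, exposure (observedSpace (W G) T N) w ∂κ
  have hR0 : ∀ w, 0 ≤ R w := fun w => integral_nonneg fun G => exposure_nonneg _ w
  have hR1 : R u ≤ 1 := by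
    calc R u ≤ ∫ _, (1 : ℝ) ∂κ :=
          integral_mono .of_finite .of_finite fun G => exposure_le_one _ u
      _ = 1 := by simp
  have hsum : ∑ w, R w ≤ T * N.ncard := by
    calc ∑ w, R w = ∫ G, ∑ w, exposure (observedSpace (W G) T N) w ∂κ :=
          (integral_finsetSum _ fun _ _ => .of_finite).symm
      _ ≤ ∫ _, (T * N.ncard : ℝ) ∂κ := integral_mono .of_finite .of_finite fun G => by
          dsimp only
          rw [sum_exposure]
          exact_mod_cast finrank_observedSpace_le (W G) T N
      _ = T * N.ncard := by simp
  have hsplit : ∑ w ∈ N.toFinset, R w + ∑ w ∈ (insert v N.toFinset)ᶜ, R w ≤ ∑ w, R w := by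
    rw [← Finset.sum_union]
    · exact Finset.sum_le_sum_of_subset_of_nonneg (Finset.subset_univ _) fun w _ _ => hR0 w
    · exact Finset.disjoint_left.2 fun w hw hw' =>
        Finset.mem_compl.1 hw' (Finset.mem_insert_of_mem hw)
  have hunseen : ∑ w ∈ (insert v N.toFinset)ᶜ, R w = ((Fintype.card V : ℝ) - N.ncard - 1) * R u := by
    have hcard : ((insert v N.toFinset)ᶜ.card : ℝ) = (Fintype.card V : ℝ) - N.ncard - 1 := by
      rw [Finset.card_compl, Nat.cast_sub (Finset.card_le_univ _),
        Finset.card_insert_of_notMem (by simpa using hvN), Set.ncard_eq_toFinset_card']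
      push_cast
      ring
    rw [Finset.sum_congr rfl (g := fun _ => R u), Finset.sum_const, nsmul_eq_mul, hcard]
    intro w hw
    simp only [Finset.mem_compl, Finset.mem_insert, Set.mem_toFinset, not_or] at hw
    exact integral_exposure_eq T hWv hw.1 hw.2 huv huN
  change ((Fintype.card V : ℝ) - N.ncard) * R u ≤ T * N.ncard
  have hN0 : 0 ≤ ∑ w ∈ N.toFinset, R w := Finset.sum_nonneg fun w _ => hR0 w
  rcases Nat.eq_zero_or_pos T with rfl | hT
  · -- all exposures vanish
    have : R u ≤ ∑ w, R w := Finset.single_le_sum (fun w _ => hR0 w) (Finset.mem_univ u)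
    have h0 : R u = 0 := le_antisymm (by simpa using this.trans hsum) (hR0 u)
    simp [h0]
  have hseen : ∑ w ∈ N.toFinset, R w = N.ncard := by
    rw [Finset.sum_congr rfl (g := fun _ => (1 : ℝ)), Finset.sum_const, nsmul_eq_mul, mul_one,
      Set.ncard_eq_toFinset_card']
    intro w hw
    have : ∀ G, exposure (observedSpace (W G) T N) w = 1 := fun G =>
      exposure_eq_one (single_mem_observedSpace (W G) hT (Set.mem_toFinset.1 hw))
    simp [R, this]
  rcases Nat.eq_zero_or_pos N.ncard with hd | hd
  · have : R u ≤ ∑ w, R w := Finset.single_le_sum (fun w _ => hR0 w) (Finset.mem_univ u)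
    have h0 : R u = 0 := le_antisymm (by simpa [hd] using this.trans hsum) (hR0 u)
    simp [h0, hd]
  · have : (1 : ℝ) ≤ N.ncard := by exact_mod_cast hd
    linarith

end randomGraph

/-! ### The privacy of a node -/

section privacy

variable {V : Type*} [Fintype V] [DecidableEq V]

theorem norm_starProjection_sq_of_adjacentData {Δ : ℝ} {u : V} {x x' : V → ℝ}
    (h : AdjacentData Δ u x x') (K : Submodule ℝ (EuclideanSpace ℝ V)) :
    ‖K.starProjection (WithLp.toLp 2 (x - x'))‖ ^ 2 = (x u - x' u) ^ 2 * exposure K u := by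
  have hx : (WithLp.toLp 2 (x - x') : EuclideanSpace ℝ V) =
      (x u - x' u) • EuclideanSpace.single u (1 : ℝ) := by
    ext w
    rcases eq_or_ne w u with rfl | hw
    · simp
    · simp [hw, h.1 w hw]
  rw [hx, map_smul, norm_smul, mul_pow, exposure, Real.norm_eq_abs, sq_abs]

/-- The view of `v` under `x` is the view under `x'` with the noise translated, in a way that
depends on the graph, by the projection of `x - x'` to the observed space. This bounds the
divergence of the views by that of the graph and the noise, before and after the translation. -/
theorem renyiDiv_viewLaw_le {u v : V} (huv : u ≠ v) {α Δ : ℝ} {σ : ℝ≥0} (hσ : σ ≠ 0)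
    (hα : 1 < α) (q : unitInterval) (W : SimpleGraph V → Matrix V V ℝ) (T : ℕ) (N : Set V)
    [IsProbabilityMeasure (graphLawGiven q v N)] {x x' : V → ℝ} (h : AdjacentData Δ u x x') :
    renyiDiv α (viewLaw q σ W T v N x) (viewLaw q σ W T v N x') ≤
      ((1 / (α - 1) : ℝ) : EReal) * ENNReal.log (∫⁻ G, ENNReal.ofReal (Real.exp
        (α * (α - 1) * (x u - x' u) ^ 2 / (2 * σ ^ 2) * exposure (observedSpace (W G) T N) u))
          ∂graphLawGiven q v N) := by
  have hv : σ ^ 2 ≠ 0 := pow_ne_zero 2 hσ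
  set κ := graphLawGiven q v N
  set ν := κ.prod (Measure.pi fun _ : V => gaussianReal 0 (σ ^ 2))
  let s : SimpleGraph V → V → ℝ := fun G =>
    (observedSpace (W G) T N).starProjection (WithLp.toLp 2 (x - x'))
  let view : (V → ℝ) → SimpleGraph V × (V → ℝ) → (Fin T → N → ℝ) × ℝ := fun y ω =>
    (fun (t : Fin T) (w : N) => muffliato (W ω.1) y ω.2 t w, y v)
  have hview : ∀ y, Measurable (view y) := fun y =>
    measurable_from_prod_countable_right fun G => by
      simp only [view, muffliato, gossipIterate_eq_mulVec, Matrix.mulVec, dotProduct, Pi.add_apply]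
      fun_prop
  have hS : Measurable fun ω : SimpleGraph V × (V → ℝ) => (ω.1, ω.2 + s ω.1) :=
    measurable_fst.prodMk (measurable_snd.add ((measurable_of_countable s).comp measurable_fst))
  have hD : Measurable fun ω : SimpleGraph V × (V → ℝ) =>
      ∏ w, gaussianShiftDensity (σ ^ 2) (s ω.1 w) (ω.2 w) :=
    measurable_from_prod_countable_right fun G => by
      dsimp only; fun_prop
  have hx' : viewLaw q σ W T v N x' = ν.map (view x') := by
    rw [viewLaw, cond_graphNoiseLaw]
  have hx : viewLaw q σ W T v N x =
      (ν.map fun ω => (ω.1, ω.2 + s ω.1)).map (view x') := by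
    rw [viewLaw, cond_graphNoiseLaw, Measure.map_map (hview x') hS]
    congr 1
    ext ω : 1
    refine Prod.ext (funext fun t => funext fun w => ?_) (h.1 v huv.symm)
    exact (muffliato_add_starProjection (W ω.1) x x' ω.2 t.2 w.2).symm
  have : IsProbabilityMeasure (ν.map fun ω => (ω.1, ω.2 + s ω.1)) :=
    Measure.isProbabilityMeasure_map hS.aemeasurable
  rw [hx, hx']
  refine (renyiDiv_map_le hD (prod_pi_gaussianReal_map_shift κ hv s) (hview x') hα).trans_eq ?_
  rw [lintegral_prod_gaussianShiftDensity_rpow κ hv s (by linarith)]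
  congr 2
  refine lintegral_congr fun G => ?_
  have hs : ∑ w, s G w ^ 2 = (x u - x' u) ^ 2 * exposure (observedSpace (W G) T N) u := by
    rw [← norm_starProjection_sq_of_adjacentData h, EuclideanSpace.real_norm_sq_eq]
  rw [hs]
  congr 2
  push_cast
  ring

theorem one_div_mul_log_le {α ε : ℝ} (hα : 1 < α) {L : ℝ≥0∞}
    (hL : L ≤ ENNReal.ofReal (Real.exp ((α - 1) * ε))) :
    ((1 / (α - 1) : ℝ) : EReal) * ENNReal.log L ≤ ε := by
  have h1 : (0 : ℝ) ≤ 1 / (α - 1) := one_div_nonneg.2 (by linarith)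
  calc ((1 / (α - 1) : ℝ) : EReal) * ENNReal.log L
      ≤ ((1 / (α - 1) : ℝ) : EReal) * (((α - 1) * ε : ℝ) : EReal) := by
        refine mul_le_mul_of_nonneg_left ?_ (by exact_mod_cast h1)
        refine (ENNReal.log_monotone hL).trans_eq ?_
        rw [ENNReal.log_ofReal_of_pos (Real.exp_pos _), Real.log_exp]
    _ = ε := by
        rw [← EReal.coe_mul]
        congr 1
        field_simp [(by linarith : α - 1 ≠ 0)]

/-- If no graph has the neighborhood `N` of `v`, then the law of the view given `N` is the zero
measure, by convention. -/
theorem isPNDP_viewLaw_of_forall {u v : V} {α Δ ε : ℝ} {σ : ℝ≥0} (hα : 1 < α) {q : unitInterval}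
    {W : SimpleGraph V → Matrix V V ℝ} {T : ℕ} {N : Set V}
    (h : IsProbabilityMeasure (graphLawGiven q v N) → IsPNDP Δ α ε u (viewLaw q σ W T v N)) :
    IsPNDP Δ α ε u (viewLaw q σ W T v N) := by
  by_cases h0 : SimpleGraph.binomialRandom V q {G | G.neighborSet v = N} = 0
  · intro x x' _
    have hz : ∀ y, viewLaw q σ W T v N y = 0 := fun y => by
      rw [viewLaw, cond_graphNoiseLaw, graphLawGiven, cond_eq_zero_of_meas_eq_zero h0,
        Measure.zero_prod, Measure.map_zero]
    rw [hz, hz, renyiDiv, if_pos .rfl, lintegral_zero_measure]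
    exact one_div_mul_log_le hα zero_le
  · exact h (cond_isProbabilityMeasure h0)

variable {u v : V} {α Δ : ℝ} {σ : ℝ≥0} {q : unitInterval} {W : SimpleGraph V → Matrix V V ℝ}

/-- The bound of local differential privacy: no exposure exceeds `1`. -/
theorem isPNDP_viewLaw_local (huv : u ≠ v) (hσ : σ ≠ 0) (hα : 1 < α) (T : ℕ) (N : Set V) :
    IsPNDP Δ α (α * Δ ^ 2 / (2 * (σ : ℝ) ^ 2)) u (viewLaw q σ W T v N) := by
  refine isPNDP_viewLaw_of_forall hα fun _ x x' hx => ?_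
  refine (renyiDiv_viewLaw_le huv hσ hα q W T N hx).trans (one_div_mul_log_le hα ?_)
  have hδ : (x u - x' u) ^ 2 ≤ Δ ^ 2 := sq_le_sq.2 (hx.2.trans (le_abs_self Δ))
  have hα1 : 0 < α - 1 := by linarith
  calc _ ≤ ∫⁻ _, ENNReal.ofReal (Real.exp ((α - 1) * (α * Δ ^ 2 / (2 * (σ : ℝ) ^ 2))))
        ∂graphLawGiven q v N := by
        refine lintegral_mono fun G => ENNReal.ofReal_le_ofReal (Real.exp_le_exp.2 ?_)
        calc _ ≤ α * (α - 1) * (x u - x' u) ^ 2 / (2 * (σ : ℝ) ^ 2) * 1 := by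
              gcongr
              exact exposure_le_one _ _
          _ ≤ α * (α - 1) * Δ ^ 2 / (2 * (σ : ℝ) ^ 2) * 1 := by gcongr
          _ = _ := by ring
    _ = _ := by simp

/-- For a node `u` that `v` does not see, the Rényi divergence is an average over the graphs, inside
an exponential. The noise is large enough for the exponent to be at most `1`, so that
`exp c ≤ 1 + 2 * c` replaces this average by the mean exposure of `u`. -/
theorem isPNDP_viewLaw_of_not_adj (huv : u ≠ v) (hσ0 : σ ≠ 0) (hα : 1 < α)
    (hσ : Δ ^ 2 * α * (α - 1) / 2 ≤ (σ : ℝ) ^ 2) (hWv : IsAnonymousAwayFrom W v) (T : ℕ)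
    {N : Set V} (hvN : v ∉ N) (huN : u ∉ N) :
    IsPNDP Δ α (α * Δ ^ 2 / (σ : ℝ) ^ 2 * (T * N.ncard / ((Fintype.card V : ℝ) - N.ncard))) u
      (viewLaw q σ W T v N) := by
  refine isPNDP_viewLaw_of_forall hα fun _ x x' hx => ?_
  refine (renyiDiv_viewLaw_le huv hσ0 hα q W T N hx).trans (one_div_mul_log_le hα ?_)
  set κ := graphLawGiven q v N
  let r : SimpleGraph V → ℝ := fun G => exposure (observedSpace (W G) T N) u
  have hr0 : ∀ G, 0 ≤ r G := fun G => exposure_nonneg _ _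
  have hr1 : ∀ G, r G ≤ 1 := fun G => exposure_le_one _ _
  have hδ : (x u - x' u) ^ 2 ≤ Δ ^ 2 := sq_le_sq.2 (hx.2.trans (le_abs_self Δ))
  have hα1 : 0 < α - 1 := by linarith
  have hσ2 : 0 < (σ : ℝ) ^ 2 := by positivity
  set c := α * (α - 1) * (x u - x' u) ^ 2 / (2 * (σ : ℝ) ^ 2) with hc
  have hc0 : 0 ≤ c := by positivity
  have hcΔ : c ≤ α * (α - 1) * Δ ^ 2 / (2 * (σ : ℝ) ^ 2) := by rw [hc]; gcongr
  have hc1 : c ≤ 1 := hcΔ.trans ((div_le_one (by positivity)).2 (by linarith))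
  have hcard : (0 : ℝ) < (Fintype.card V : ℝ) - N.ncard := by
    have : N.ncard < Nat.card V := by
      rw [← Set.ncard_univ]
      exact Set.ncard_lt_ncard (Set.ssubset_univ_iff.2 fun h => huN (h ▸ trivial))
    rw [Nat.card_eq_fintype_card] at this
    exact sub_pos.2 (by exact_mod_cast this)
  have hR : ∫ G, r G ∂κ ≤ T * N.ncard / ((Fintype.card V : ℝ) - N.ncard) :=
    (le_div_iff₀' hcard).2 (integral_exposure_le T hWv hvN huv huN)
  have hexp : ∀ G, Real.exp (c * r G) ≤ 1 + 2 * c * r G := fun G => by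
    have h0 : 0 ≤ c * r G := mul_nonneg hc0 (hr0 G)
    have h1 : c * r G ≤ 1 := mul_le_one₀ hc1 (hr0 G) (hr1 G)
    have := Real.abs_exp_sub_one_le (by rwa [abs_of_nonneg h0])
    rw [abs_of_nonneg h0] at this
    linarith [(abs_le.1 this).2]
  calc ∫⁻ G, ENNReal.ofReal (Real.exp (c * r G)) ∂κ
      ≤ ∫⁻ G, ENNReal.ofReal (1 + 2 * c * r G) ∂κ :=
        lintegral_mono fun G => ENNReal.ofReal_le_ofReal (hexp G)
    _ = ENNReal.ofReal (1 + 2 * c * ∫ G, r G ∂κ) := by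
        rw [← ofReal_integral_eq_lintegral_ofReal .of_finite
          (Filter.Eventually.of_forall fun G => by
            have := hr0 G
            positivity), integral_add .of_finite .of_finite, integral_const_mul]
        simp
    _ ≤ _ := by
        refine ENNReal.ofReal_le_ofReal ?_
        refine (add_comm _ _).trans_le ((Real.add_one_le_exp _).trans (Real.exp_le_exp.2 ?_))
        calc 2 * c * ∫ G, r G ∂κ
            ≤ 2 * (α * (α - 1) * Δ ^ 2 / (2 * (σ : ℝ) ^ 2)) *
                (T * N.ncard / ((Fintype.card V : ℝ) - N.ncard)) := by
              gcongr
              exact integral_nonneg hr0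
          _ = _ := by field_simp

end privacy

theorem theorem4 {V : Type*} [Fintype V] [DecidableEq V] (u v : V) (huv : u ≠ v)
    (α Δ c : ℝ) (σ : ℝ≥0) (T : ℕ) (q : unitInterval)
    (hα : 1 < α) (hΔ : 0 < Δ) (hσ : Δ ^ 2 * α * (α - 1) / 2 ≤ (σ : ℝ) ^ 2)
    (hc : 1 < c) (hq : (q : ℝ) = c * (Real.log (Fintype.card V) / Fintype.card V))
    (W : SimpleGraph V → Matrix V V ℝ) (hW : ∀ G, IsGossipMatrix G (W G))
    (hWv : IsAnonymousAwayFrom W v) :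
    (SimpleGraph.binomialRandom V q).real
        {G | G.Adj u v ∧
          IsPNDP Δ α (α * Δ ^ 2 / (2 * (σ : ℝ) ^ 2)) u
            (viewLaw q σ W T v (G.neighborSet v))} = q ∧
    (SimpleGraph.binomialRandom V q).real
        {G | ¬ G.Adj u v ∧
          IsPNDP Δ α
            (α * Δ ^ 2 / (σ : ℝ) ^ 2 * (T * (G.neighborSet v).ncard /
              ((Fintype.card V : ℝ) - (G.neighborSet v).ncard))) u
            (viewLaw q σ W T v (G.neighborSet v))} = 1 - q := by
  have hσ0 : σ ≠ 0 := by
    rintro rfl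
    have : 0 < Δ ^ 2 * α * (α - 1) / 2 := by
      have := sub_pos.2 hα
      positivity
    norm_num at hσ
    linarith
  constructor
  · rw [← binomialRandom_real_adj q huv]
    congr 1
    ext G
    exact and_iff_left (isPNDP_viewLaw_local huv hσ0 hα T _)
  · have hset : {G : SimpleGraph V | ¬ G.Adj u v ∧ IsPNDP Δ α
        (α * Δ ^ 2 / (σ : ℝ) ^ 2 * (T * (G.neighborSet v).ncard /
          ((Fintype.card V : ℝ) - (G.neighborSet v).ncard))) u
        (viewLaw q σ W T v (G.neighborSet v))} = {G | G.Adj u v}ᶜ := by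
      ext G
      refine and_iff_left_of_imp fun h => isPNDP_viewLaw_of_not_adj huv hσ0 hα hσ hWv T ?_ ?_
      · simp
      · exact fun h' => h (SimpleGraph.Adj.symm h')
    rw [hset, probReal_compl_eq_one_sub (Set.toFinite _).measurableSet,
      binomialRandom_real_adj q huv]
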